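/- Let $\mathcal{A}$ be a semi-abelian category, that is, a category with a zero object which is Barr exact (finitely complete, with coequalizers of kernel pairs, with pullback-stable regular epimorphisms, and such that every internal equivalence relation is a kernel pair), Bourn protomodular and has binary coproducts. Assume that $\mathcal{A}$ has enough (regular) projectives: for every object $A$ there is a regular epimorphism $P\to A$ with $P$ projective with respect to regular epimorphisms. Two morphisms $k\colon K\to X$ and $k'\colon K'\to X$ are said to cooperate if there is a morphism $\varphi\colon K\times K'\to X$ with $\varphi\circ(1_K,0)=k$ and $\varphi\circ(0,1_{K'})=k'$. An object $A$ is abelian if $1_A$ cooperates with $1_A$, and $\mathsf{Ab}\mathcal{A}$ denotes the full subcategory of abelian objects. An object $Y$ is perfect if its reflection $\mathrm{Ab}(Y)$ into $\mathsf{Ab}\mathcal{A}$ is zero, i.e. if a zero object is a reflection of $Y$ into $\mathsf{Ab}\mathcal{A}$. A central extension of $Y$ is a regular epimorphism $f\colon X\to Y$ whose kernel $\ker f\colon K\to X$ cooperates with $1_X$; $\mathsf{Centr}(Y)$ denotes the full subcategory of the slice category $\mathcal{A}/Y$ determined by the central extensions of $Y$. A universal central extension of $Y$ is an initial object of $\mathsf{Centr}(Y)$.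 Then an object $Y$ of $\mathcal{A}$ is perfect if and only if it admits a universal central extension. -/

import Mathlib

open CategoryTheory CategoryTheory.Limits

universe v u

namespace SemiAb

/-- A (Barr) exact category: a regular category in which every internal equivalence relation
is the kernel pair of some morphism. -/
class BarrExact (C : Type u) [Category.{v} C] : Prop extends Regular C where
  isKernelPair_of_isEquivalenceRelation : ∀ {R X : C} (p₁ p₂ : R ⟶ X),
    IsEquivalenceRelation p₁ p₂ → ∃ (Q : C) (q : X ⟶ Q), IsKernelPair q p₁ p₂

/-- (Bourn) protomodularity: in a commutative diagram
```
  A --f--> B --g--> D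
  |a       |b       |d
  A' -f'-> B' -g'-> D'
```
with `b` a split epimorphism, if the left hand square and the outer rectangle are pullbacks,
then so is the right hand square. -/
class Protomodular (C : Type u) [Category.{v} C] : Prop where
  isPullback_right : ∀ {A B D A' B' D' : C} (f : A ⟶ B) (g : B ⟶ D) (f' : A' ⟶ B') (g' : B' ⟶ D')
    (a : A ⟶ A') (b : B ⟶ B') (d : D ⟶ D'), IsSplitEpi b →
    CommSq f a b f' → CommSq g b d g' →
    IsPullback f a b f' → IsPullback (f ≫ g) a d (f' ≫ g') → IsPullback g b d g'

/-- A semi-abelian category: pointed, Barr exact, Bourn protomodular, with binary coproducts.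
Zero morphisms, which are determined by the zero object, are provided separately by Mathlib's
class `HasZeroMorphisms`. -/
class SemiAbelianCategory (C : Type u) [Category.{v} C] : Prop extends
    BarrExact C, Protomodular C where
  hasZeroObject : HasZeroObject C
  hasBinaryCoproducts : HasBinaryCoproducts C

/-- (Regular) projective objects: those having the lifting property against all regular
epimorphisms. (Mathlib's `Projective` refers to all epimorphisms.) -/
def IsRegularProjective {C : Type u} [Category.{v} C] (P : C) : Prop :=
  ∀ {E B : C} (p : E ⟶ B), IsRegularEpi p → ∀ f : P ⟶ B, ∃ f' : P ⟶ E, f' ≫ p = f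

/-- Enough (regular) projectives: every object is the codomain of a regular epimorphism with
projective domain. -/
def HasEnoughRegularProjectives (C : Type u) [Category.{v} C] : Prop :=
  ∀ A : C, ∃ (P : C) (p : P ⟶ A), IsRegularProjective P ∧ IsRegularEpi p

section Pointed

variable {C : Type u} [Category.{v} C] [HasZeroMorphisms C] [HasFiniteLimits C]

/-- Two morphisms `k : K ⟶ X` and `k' : K' ⟶ X` cooperate when there is a morphism
`φ : K × K' ⟶ X` (a cooperator) with `φ ∘ (1, 0) = k` and `φ ∘ (0, 1) = k'`. -/
def Cooperate {K K' X : C} (k : K ⟶ X) (k' : K' ⟶ X) : Prop :=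
  ∃ φ : K ⨯ K' ⟶ X, prod.lift (𝟙 K) 0 ≫ φ = k ∧ prod.lift 0 (𝟙 K') ≫ φ = k'

variable (C) in
/-- Abelian objects: those objects `A` whose identity cooperates with itself. -/
def isAbelianObject : ObjectProperty C := fun A => Cooperate (𝟙 A) (𝟙 A)

variable (C) in
/-- The full subcategory `Ab C` of abelian objects. -/
abbrev Ab : Type u := (isAbelianObject C).FullSubcategory

/-- A pair `(A, η : Y ⟶ A)` with `A` abelian is a reflection of `Y` into `Ab C` when it is
universal among morphisms from `Y` to abelian objects. -/
def IsAbelianization {Y : C} (T : StructuredArrow Y (isAbelianObject C).ι) : Prop :=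
  Nonempty (IsInitial T)

/-- `Y` is perfect when it has a zero object as its reflection `Ab(Y)` into `Ab C`. -/
def IsPerfect (Y : C) : Prop :=
  ∃ T : StructuredArrow Y (isAbelianObject C).ι, IsAbelianization T ∧ IsZero T.right.obj

/-- A morphism `f : X ⟶ Y` is a central extension of `Y` when it is a regular epimorphism whose
kernel is central in the sense of Huq, that is, `ker f` cooperates with `1_X`. -/
def isCentralExtension (Y : C) : ObjectProperty (Over Y) :=
  fun f => IsRegularEpi f.hom ∧ Cooperate (kernel.ι f.hom) (𝟙 f.left)

/-- The category `Centr(Y)` of central extensions of `Y`, a full subcategory of the slice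
category over `Y`. -/
abbrev Centr (Y : C) : Type (max u v) := (isCentralExtension Y).FullSubcategory

/-- A universal central extension of `Y` is an initial object of `Centr(Y)`. -/
def IsUniversalCentralExtension {Y : C} (U : Centr Y) : Prop :=
  Nonempty (IsInitial U)

end Pointed

end SemiAb

/-! If `U` is initial among central extensions `u : U ⟶ Y` and `f : Y ⟶ A` has abelian codomain,
then `(u, u ≫ f)` and `(u, 0)` are both morphisms from `U` to the central extension `Y ⨯ A ⟶ Y`.
They agree, and `u` is epic, so `f = 0`.

Conversely, let `P ⟶ Y` be a projective cover with kernel `K`. Making `K` central in `P` gives a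
weakly initial central extension `F ⟶ Y`, classically `P/[K,P]`. The candidate is the commutator
`[F,F]`, the kernel of `F ⟶ Ab(F)`. When `Y` is perfect, `[F,F]` still covers `Y`
(`isRegularEpi_kernel_abelianization_comp`) and is perfect (`isPerfect_kernel_abelianization`). Maps
from a perfect object to a central extension are unique over `Y` (`eq_of_isPerfect_of_central`), so
weak initiality becomes initiality.

The exactness arguments rest on `exists_regularPushout`, which replaces element chasing. -/

namespace SemiAb

open scoped ZeroObject

attribute [local simp] prod.lift_fst prod.lift_snd prod.lift_fst_assoc prod.lift_snd_assoc
  pullback.lift_fst pullback.lift_snd pullback.lift_fst_assoc pullback.lift_snd_assoc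
  coprod.inl_desc coprod.inr_desc kernel.lift_ι kernel.lift_ι_assoc

/-! ### Protomodular categories are Mal'tsev. -/

section Maltsev

variable {C : Type u} [Category.{v} C]

/-- In a protomodular category, a subobject of the domain of `d : W ⟶ B` containing both a section
of `d` and the pullback of `d` along some `f` is everything. -/
lemma isIso_of_isPullback_of_section [Protomodular C] {A M W B₀ B : C} {f : B₀ ⟶ B} {d : W ⟶ B}
    {i : A ⟶ M} {a : A ⟶ B₀} (m : M ⟶ W) [Mono m] (h : IsPullback (i ≫ m) a d f)
    (s : B ⟶ M) (hs : s ≫ m ≫ d = 𝟙 B) : IsIso m := by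
  have w : i ≫ m ≫ d = a ≫ f := by simpa using h.w
  have left : IsPullback i a (m ≫ d) f := IsPullback.mk' w
    (fun T φ φ' h₁ h₂ => h.hom_ext (by simp [reassoc_of% h₁]) h₂)
    (fun T x y hxy => ⟨h.lift (x ≫ m) y (by simpa using hxy),
      by rw [← cancel_mono m, Category.assoc, h.lift_fst], h.lift_snd _ _ _⟩)
  have : IsSplitEpi (m ≫ d) := IsSplitEpi.mk' ⟨s, hs⟩
  exact (Protomodular.isPullback_right i m f (𝟙 B) a (m ≫ d) d this ⟨w⟩ ⟨by simp⟩ left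
    (by simpa using h)).isIso_fst_of_isIso

/-- Every relation in a protomodular category is difunctional. -/
lemma exists_of_difunctional [HasFiniteLimits C] [Protomodular C] {T X Y Z : C}
    (r₁ : T ⟶ X) (r₂ : T ⟶ Y) [JointlyMono₂ r₁ r₂] (t₁ t₂ t₃ : Z ⟶ T)
    (h₁₂ : t₁ ≫ r₂ = t₂ ≫ r₂) (h₂₃ : t₂ ≫ r₁ = t₃ ≫ r₁) :
    ∃ t : Z ⟶ T, t ≫ r₁ = t₁ ≫ r₁ ∧ t ≫ r₂ = t₃ ≫ r₂ := by
  let R₂ := pullback r₂ r₂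
  let R₁ := pullback r₁ r₁
  let p : pullback (pullback.snd r₂ r₂) (pullback.fst r₁ r₁) ⟶ R₂ := pullback.fst _ _
  let q : pullback (pullback.snd r₂ r₂) (pullback.fst r₁ r₁) ⟶ R₁ := pullback.snd _ _
  let δ₁ : T ⟶ R₁ := pullback.lift (𝟙 T) (𝟙 T) rfl
  let δ₂ : T ⟶ R₂ := pullback.lift (𝟙 T) (𝟙 T) rfl
  let r : T ⟶ X ⨯ Y := prod.lift r₁ r₂
  let w := prod.lift (p ≫ pullback.fst r₂ r₂ ≫ r₁) (q ≫ pullback.snd r₁ r₁ ≫ r₂)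
  have : Mono r := ⟨fun f g h => JointlyMono₂.right_cancellation (p₁ := r₁) (p₂ := r₂) f g
    (by simpa [r, prod.comp_lift] using h =≫ prod.fst) (by simpa [r] using h =≫ prod.snd)⟩
  -- `m` is the subobject of triples `(t₁, t₂, t₃)` satisfying the conclusion. It contains the
  -- triples `(t₁, t₂, t₂)` (`j`, a pullback of `δ₁` along `q`) and `(t₂, t₂, t₃)` (`l`, a section
  -- of `q`), hence everything.
  let m : pullback r w ⟶ _ := pullback.snd r w
  let j : R₂ ⟶ pullback (pullback.snd r₂ r₂) (pullback.fst r₁ r₁) :=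
    pullback.lift (𝟙 _) (pullback.snd r₂ r₂ ≫ δ₁) (by simp [δ₁])
  have hjp : j ≫ p = 𝟙 _ := by simp [j, p]
  have hjq : j ≫ q = pullback.snd r₂ r₂ ≫ δ₁ := by simp [j, q]
  let l : R₁ ⟶ pullback (pullback.snd r₂ r₂) (pullback.fst r₁ r₁) :=
    pullback.lift (pullback.fst r₁ r₁ ≫ δ₂) (𝟙 _) (by simp [δ₂])
  have hlp : l ≫ p = pullback.fst r₁ r₁ ≫ δ₂ := by simp [l, p]
  have hlq : l ≫ q = 𝟙 _ := by simp [l, q]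
  have hδ₁ : δ₁ ≫ pullback.fst r₁ r₁ = 𝟙 _ := by simp [δ₁]
  have hδ₁' : δ₁ ≫ pullback.snd r₁ r₁ = 𝟙 _ := by simp [δ₁]
  have hδ₂ : δ₂ ≫ pullback.fst r₂ r₂ = 𝟙 _ := by simp [δ₂]
  let i : R₂ ⟶ pullback r w := pullback.lift (pullback.fst r₂ r₂) j (by
    ext
    · simp [r, w, reassoc_of% hjp]
    · simp [r, w, reassoc_of% hjq, reassoc_of% hδ₁', pullback.condition])
  let s : R₁ ⟶ pullback r w := pullback.lift (pullback.snd r₁ r₁) l (by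
    ext
    · simp [r, w, reassoc_of% hlp, reassoc_of% hδ₂, pullback.condition]
    · simp [r, w, reassoc_of% hlq])
  have him : i ≫ m = j := by simp [i, m]
  have hsm : s ≫ m = l := by simp [s, m]
  have hj : IsPullback j (pullback.snd r₂ r₂) q δ₁ := by
    refine IsPullback.of_right (h₁₂ := p) (h₂₂ := pullback.fst r₁ r₁) ?_ hjq
      (IsPullback.of_hasPullback _ _)
    rw [hjp, hδ₁]
    exact IsPullback.id_horiz _
  have : IsIso m := isIso_of_isPullback_of_section (i := i) m (by rwa [him]) s
    (by rw [reassoc_of% hsm, hlq])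
  let z : Z ⟶ pullback (pullback.snd r₂ r₂) (pullback.fst r₁ r₁) :=
    pullback.lift (pullback.lift t₁ t₂ h₁₂) (pullback.lift t₂ t₃ h₂₃) (by simp)
  have hzp : z ≫ p ≫ pullback.fst r₂ r₂ = t₁ := by simp [z, p]
  have hzq : z ≫ q ≫ pullback.snd r₁ r₁ = t₃ := by simp [z, q]
  have key : (z ≫ inv m ≫ pullback.fst r w) ≫ r = z ≫ w := by
    simp [pullback.condition, m]
  refine ⟨z ≫ inv m ≫ pullback.fst r w, ?_, ?_⟩
  · have := key =≫ prod.fst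
    simp only [r, w, Category.assoc, prod.lift_fst] at this
    rw [← hzp]; simpa using this
  · have := key =≫ prod.snd
    simp only [r, w, Category.assoc, prod.lift_snd] at this
    rw [← hzq]; simpa using this

/-- Reflexive relations in a protomodular category are equivalence relations. -/
lemma isEquivalenceRelation_of_reflexive [HasFiniteLimits C] [Protomodular C] {T X : C}
    (r₁ r₂ : T ⟶ X) [JointlyMono₂ r₁ r₂] (ρ : X ⟶ T) (h₁ : ρ ≫ r₁ = 𝟙 X) (h₂ : ρ ≫ r₂ = 𝟙 X) :
    IsEquivalenceRelation r₁ r₂ := by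
  -- On elements: `(y,y), (x,y), (x,x)` yield `(y,x)`, and `(x,y), (y,y), (y,z)` yield `(x,z)`.
  obtain ⟨s, hs₁, hs₂⟩ := exists_of_difunctional r₁ r₂ (r₂ ≫ ρ) (𝟙 T) (r₁ ≫ ρ)
    (by simp [h₂]) (by simp [h₁])
  obtain ⟨t, ht₁, ht₂⟩ := exists_of_difunctional r₁ r₂ (pullback.fst r₂ r₁)
    (pullback.fst r₂ r₁ ≫ r₂ ≫ ρ) (pullback.snd r₂ r₁)
    (by simp [h₂]) (by simp [h₁, pullback.condition])
  exact ⟨⟨{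
    right_cancellation := JointlyMono₂.right_cancellation
    r := ρ
    reflexivity₁ := h₁
    reflexivity₂ := h₂
    s := s
    symmetry₁ := by simpa [h₁] using hs₁
    symmetry₂ := by simpa [h₂] using hs₂
    c := pullback.cone r₂ r₁
    isLimit := pullback.isLimit r₂ r₁
    t := t
    transitivity₁ := ht₁
    transitivity₂ := ht₂ }⟩⟩

end Maltsev

/-! ### Images of kernel pairs and regular pushouts. -/

section RegularPushout

variable {C : Type u} [Category.{v} C]

/-- Regular epimorphisms are stable under pullback. -/
lemma isRegularEpi_fst_of_isPullback [Regular C] {P X Y Z : C} {a : P ⟶ X} {b : P ⟶ Y}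
    {f : X ⟶ Z} {g : Y ⟶ Z} (h : IsPullback a b f g) [hg : IsRegularEpi g] : IsRegularEpi a :=
  Regular.regularEpiIsStableUnderBaseChange.of_isPullback h.flip hg

lemma isRegularEpi_comp [Regular C] {X Y Z : C} (f : X ⟶ Y) (g : Y ⟶ Z)
    [IsRegularEpi f] [IsRegularEpi g] : IsRegularEpi (f ≫ g) :=
  inferInstance

lemma isRegularEpi_of_comp [Regular C] {X Y Z : C} (f : X ⟶ Y) (g : Y ⟶ Z)
    [IsRegularEpi (f ≫ g)] : IsRegularEpi g :=
  have := strongEpi_of_strongEpi f g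
  inferInstance

/-- A factorisation of a regular epimorphism through a monomorphism. -/
lemma isIso_of_isRegularEpi_comp [Regular C] {X Y Z : C} (f : X ⟶ Y) (m : Y ⟶ Z) [Mono m]
    [IsRegularEpi (f ≫ m)] : IsIso m :=
  ExtremalEpi.isIso (f ≫ m) f m rfl

/-- In an exact protomodular category, the image of a kernel pair `(r₁, r₂)` along a regular
epimorphism `h` is a kernel pair. -/
lemma exists_isKernelPair_image [BarrExact C] [Protomodular C] {A D F R : C} {p : A ⟶ D}
    {r₁ r₂ : R ⟶ A} (hp : IsKernelPair p r₁ r₂) (h : A ⟶ F) [IsRegularEpi h] :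
    ∃ (G T : C) (g : F ⟶ G) (t₁ t₂ : T ⟶ F) (e : R ⟶ T), IsRegularEpi g ∧
      IsKernelPair g t₁ t₂ ∧ IsRegularEpi e ∧ e ≫ t₁ = r₁ ≫ h ∧ e ≫ t₂ = r₂ ≫ h := by
  let φ := Regular.strongEpiMonoFactorisation (prod.lift (r₁ ≫ h) (r₂ ≫ h))
  let t₁ := φ.m ≫ prod.fst
  let t₂ := φ.m ≫ prod.snd
  have he₁ : φ.e ≫ t₁ = r₁ ≫ h := by simp [t₁, reassoc_of% φ.fac]
  have he₂ : φ.e ≫ t₂ = r₂ ≫ h := by simp [t₂, reassoc_of% φ.fac]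
  have : JointlyMono₂ t₁ t₂ := ⟨fun Y f g hf hg => by
    rw [← cancel_mono φ.m]
    ext <;> simpa [t₁, t₂]⟩
  let ρ : A ⟶ R := hp.lift (𝟙 A) (𝟙 A) rfl
  -- The image relation is reflexive because the diagonal of `F` lifts against the strong
  -- epimorphism `h`.
  have sq : CommSq (ρ ≫ φ.e) h φ.m (prod.lift (𝟙 F) (𝟙 F)) := ⟨by
    ext
    · simp [ρ]
    · simp [ρ]⟩
  have hφ : Mono φ.m := φ.m_mono
  have hr := isEquivalenceRelation_of_reflexive t₁ t₂ sq.lift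
    (by simp [t₁]) (by simp [t₂])
  obtain ⟨Q, q, hq⟩ := BarrExact.isKernelPair_of_isEquivalenceRelation t₁ t₂ hr
  have := Regular.hasCoequalizer_of_isKernelPair hq
  refine ⟨coequalizer t₁ t₂, φ.I, coequalizer.π t₁ t₂, t₁, t₂, φ.e, inferInstance, ?_,
    inferInstance, he₁, he₂⟩
  exact IsKernelPair.cancel_right (f₂ := coequalizer.desc q hq.w) (coequalizer.condition _ _)
    (by simpa using hq)

/-- In an exact protomodular category, regular epimorphisms with common domain fit in a pushout square of
regular epimorphisms, which is moreover a regular pushout: the comparison morphism to the pullback is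
a regular epimorphism. -/
theorem exists_regularPushout [BarrExact C] [Protomodular C] {A D F : C} (h : A ⟶ F) (p : A ⟶ D)
    [IsRegularEpi h] [IsRegularEpi p] :
    ∃ (G : C) (g : F ⟶ G) (g' : D ⟶ G), h ≫ g = p ≫ g' ∧ IsRegularEpi g ∧ IsRegularEpi g' ∧
      (∀ {T : C} (x : F ⟶ T) (z : D ⟶ T), h ≫ x = p ≫ z → ∃ y, g ≫ y = x ∧ g' ≫ y = z) ∧
      ∀ {W : C} (x : W ⟶ F) (d : W ⟶ D) (l : A ⟶ W), IsPullback x d g g' → l ≫ x = h →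
        l ≫ d = p → IsRegularEpi l := by
  have kp := IsKernelPair.of_hasPullback p
  obtain ⟨G, T, g, t₁, t₂, e, hg, kg, he, he₁, he₂⟩ := exists_isKernelPair_image kp h
  obtain ⟨g', hg'⟩ := IsRegularEpi.exists_of_isKernelPair p kp (h ≫ g) (by
    rw [← reassoc_of% he₁, ← reassoc_of% he₂, kg.w])
  have : IsRegularEpi (p ≫ g') := hg' ▸ isRegularEpi_comp h g
  refine ⟨G, g, g', hg'.symm, hg, isRegularEpi_of_comp p g', fun {T'} x z hxz => ?_, ?_⟩
  · obtain ⟨y, hy⟩ := IsRegularEpi.exists_of_isKernelPair g kg x (by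
      rw [← cancel_epi e, reassoc_of% he₁, reassoc_of% he₂, hxz, reassoc_of% kp.w])
    refine ⟨y, hy, ?_⟩
    rw [← cancel_epi p, reassoc_of% hg', hy, hxz]
  · intro W x d l hW hx hd
    let φ := Regular.strongEpiMonoFactorisation l
    have hφ : Mono φ.m := φ.m_mono
    have fac₁ : φ.e ≫ φ.m ≫ x = h := by rw [reassoc_of% φ.fac, hx]
    have fac₂ : φ.e ≫ φ.m ≫ d = p := by rw [reassoc_of% φ.fac, hd]
    have : JointlyMono₂ (φ.m ≫ x) (φ.m ≫ d) := ⟨fun Y f f' h₁ h₂ => by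
      rw [← cancel_mono φ.m]
      exact hW.hom_ext (by simpa using h₁) (by simpa using h₂)⟩
    -- Given `w` in `W`, choose `a` with `p a = d w`. Then `h a` and `x w` have the same image under
    -- `g`, so, after a cover, they are the images under `h` of some `a₁, a₂` with `p a₁ = p a₂`.
    -- Difunctionality of the image of `l` applied to `a₂, a₁, a` puts `w` in that image.
    let a := pullback.fst p d
    let c := pullback.snd p d
    have hac : a ≫ p = c ≫ d := pullback.condition
    let b : pullback p d ⟶ T := kg.lift (a ≫ h) (c ≫ x) (by
      rw [Category.assoc, ← hg', reassoc_of% hac, Category.assoc, hW.w])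
    have hb₁ : b ≫ t₁ = a ≫ h := by simp [b]
    have hb₂ : b ≫ t₂ = c ≫ x := by simp [b]
    let u := pullback.fst e b
    let c' := pullback.snd e b
    have hu : u ≫ e = c' ≫ b := pullback.condition
    have hu₁ : u ≫ pullback.fst p p ≫ h = c' ≫ a ≫ h := by
      rw [← he₁, reassoc_of% hu, hb₁]
    have hu₂ : u ≫ pullback.snd p p ≫ h = c' ≫ c ≫ x := by
      rw [← he₂, reassoc_of% hu, hb₂]
    obtain ⟨t, ht₁, ht₂⟩ := exists_of_difunctional (φ.m ≫ x) (φ.m ≫ d)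
      (u ≫ pullback.snd p p ≫ φ.e) (u ≫ pullback.fst p p ≫ φ.e) (c' ≫ a ≫ φ.e)
      (by simp [fac₂, pullback.condition]) (by simpa [fac₁] using hu₁)
    have ht : t ≫ φ.m = c' ≫ c := hW.hom_ext
      (by simpa [fac₁, hu₂] using ht₁) (by simpa [fac₂, hac] using ht₂)
    have : IsRegularEpi (t ≫ φ.m) := ht ▸ isRegularEpi_comp c' c
    have := isIso_of_isRegularEpi_comp t φ.m
    rw [← φ.fac]
    exact isRegularEpi_comp _ _

end RegularPushout

/-! ### Cooperating morphisms, abelian objects and perfect objects. -/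

section Cooperators

variable {C : Type u} [Category.{v} C] [HasZeroMorphisms C]

lemma isPullback_zero_of_kernel {Z K W B : C} (hZ : IsZero Z) {k : K ⟶ W} {d : W ⟶ B} [Mono k]
    (w : k ≫ d = 0) (h : ∀ {T : C} (t : T ⟶ W), t ≫ d = 0 → ∃ l, l ≫ k = t) :
    IsPullback k (0 : K ⟶ Z) d (0 : Z ⟶ B) :=
  IsPullback.mk' (by simp [w]) (fun T φ φ' h₁ _ => (cancel_mono k).1 h₁)
    (fun T x y hxy => (h x (by simpa using hxy)).imp fun l hl => ⟨hl, hZ.eq_of_tgt _ _⟩)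

/-- In a pointed protomodular category, a kernel and a section of a split epimorphism are jointly
extremally epic. -/
lemma isIso_of_kernel_of_section [HasZeroObject C] [Protomodular C] {K M W B : C} {k : K ⟶ W}
    {d : W ⟶ B} [Mono k] (w : k ≫ d = 0) (h : ∀ {T : C} (t : T ⟶ W), t ≫ d = 0 → ∃ l, l ≫ k = t)
    (m : M ⟶ W) [Mono m] (i : K ⟶ M) (hi : i ≫ m = k) (s : B ⟶ M) (hs : s ≫ m ≫ d = 𝟙 B) :
    IsIso m :=
  isIso_of_isPullback_of_section (i := i) m
    (hi ▸ isPullback_zero_of_kernel (isZero_zero C) w h) s hs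

instance [SemiAbelianCategory C] : HasZeroObject C := SemiAbelianCategory.hasZeroObject

instance [SemiAbelianCategory C] : HasBinaryCoproducts C :=
  SemiAbelianCategory.hasBinaryCoproducts

variable [SemiAbelianCategory C]

/-- The first axis is the kernel of the second projection and the second axis is a section of it.
This makes cooperators unique. -/
lemma isIso_of_prod_factors {K L M : C} (m : M ⟶ K ⨯ L) [Mono m] (i : K ⟶ M) (j : L ⟶ M)
    (hi : i ≫ m = prod.lift (𝟙 K) 0) (hj : j ≫ m = prod.lift 0 (𝟙 L)) : IsIso m :=
  isIso_of_kernel_of_section (k := prod.lift (𝟙 K) (0 : K ⟶ L)) (d := prod.snd) (by simp)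
    (fun t ht => ⟨t ≫ prod.fst, by ext <;> simp [ht]⟩) m i hi j (by simp [reassoc_of% hj])

lemma prod_hom_ext {K L Z : C} {f g : K ⨯ L ⟶ Z}
    (h₁ : prod.lift (𝟙 K) 0 ≫ f = prod.lift (𝟙 K) 0 ≫ g)
    (h₂ : prod.lift 0 (𝟙 L) ≫ f = prod.lift 0 (𝟙 L) ≫ g) : f = g := by
  have := isIso_of_prod_factors (equalizer.ι f g) (equalizer.lift _ h₁) (equalizer.lift _ h₂)
    (by simp) (by simp)
  exact (cancel_epi (equalizer.ι f g)).1 (equalizer.condition f g)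

instance isRegularEpi_coprod_to_prod (K L : C) :
    IsRegularEpi (coprod.desc (prod.lift (𝟙 K) (0 : K ⟶ L)) (prod.lift (0 : L ⟶ K) (𝟙 L))) := by
  let φ := Regular.strongEpiMonoFactorisation
    (coprod.desc (prod.lift (𝟙 K) (0 : K ⟶ L)) (prod.lift (0 : L ⟶ K) (𝟙 L)))
  have hφ : Mono φ.m := φ.m_mono
  have := isIso_of_prod_factors φ.m (coprod.inl ≫ φ.e) (coprod.inr ≫ φ.e)
    (by rw [Category.assoc, φ.fac, coprod.inl_desc])
    (by rw [Category.assoc, φ.fac, coprod.inr_desc])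
  rw [← φ.fac]
  exact isRegularEpi_comp _ _

namespace Cooperate

variable {K K' X : C} {k : K ⟶ X} {k' : K' ⟶ X}

lemma symm (h : Cooperate k k') : Cooperate k' k := by
  obtain ⟨φ, h₁, h₂⟩ := h
  refine ⟨prod.lift prod.snd prod.fst ≫ φ, ?_, ?_⟩
  · rw [← h₂, prod.comp_lift_assoc]; simp
  · rw [← h₁, prod.comp_lift_assoc]; simp

lemma comp (h : Cooperate k k') {Y : C} (t : X ⟶ Y) : Cooperate (k ≫ t) (k' ≫ t) := by
  obtain ⟨φ, h₁, h₂⟩ := h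
  exact ⟨φ ≫ t, by rw [reassoc_of% h₁], by rw [reassoc_of% h₂]⟩

lemma precomp (h : Cooperate k k') {L L' : C} (a : L ⟶ K) (b : L' ⟶ K') :
    Cooperate (a ≫ k) (b ≫ k') := by
  obtain ⟨φ, h₁, h₂⟩ := h
  refine ⟨prod.map a b ≫ φ, ?_, ?_⟩
  · rw [← h₁, ← Category.assoc, ← Category.assoc]; congr 1; ext <;> simp
  · rw [← h₂, ← Category.assoc, ← Category.assoc]; congr 1; ext <;> simp

/-- The inverse image of `m` under the cooperator contains both axes, so it is the whole product. -/
lemma of_comp_mono {Y : C} (m : X ⟶ Y) [Mono m] (h : Cooperate (k ≫ m) (k' ≫ m)) :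
    Cooperate k k' := by
  obtain ⟨φ, h₁, h₂⟩ := h
  have := isIso_of_prod_factors (pullback.snd m φ) (pullback.lift k _ h₁.symm)
    (pullback.lift k' _ h₂.symm) (by simp) (by simp)
  have w : (inv (pullback.snd m φ) ≫ pullback.fst m φ) ≫ m = φ := by simp [pullback.condition]
  refine ⟨inv (pullback.snd m φ) ≫ pullback.fst m φ, ?_, ?_⟩
  · rw [← cancel_mono m, Category.assoc, w, h₁]
  · rw [← cancel_mono m, Category.assoc, w, h₂]

/-- The cooperator descends along the regular epimorphism `e × 1`: it identifies the kernel pair, as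
can be tested on the axes. -/
lemma of_regularEpi_comp_left {L : C} (e : L ⟶ K) [IsRegularEpi e] (h : Cooperate (e ≫ k) k') :
    Cooperate k k' := by
  obtain ⟨φ, h₁, h₂⟩ := h
  have hp : IsPullback (prod.map e (𝟙 K')) prod.fst prod.fst e :=
    (IsPullback.of_prod_fst_with_id e K').flip
  have := isRegularEpi_fst_of_isPullback hp
  have kp := IsKernelPair.of_hasPullback e
  have kp' : IsKernelPair (prod.map e (𝟙 K')) (prod.map (pullback.fst e e) (𝟙 K'))
      (prod.map (pullback.snd e e) (𝟙 K')) := by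
    refine IsPullback.mk' (by rw [prod.map_map, prod.map_map, kp.w]) ?_ ?_
    · intro T a b ha hb
      have ha₁ := ha =≫ prod.fst
      have ha₂ := ha =≫ prod.snd
      have hb₁ := hb =≫ prod.fst
      simp only [Category.assoc, prod.map_fst, prod.map_snd, Category.comp_id] at ha₁ ha₂ hb₁
      ext
      · simpa using ha₁
      · simpa using hb₁
      · exact ha₂
    · intro T a b hab
      have h₁ := hab =≫ prod.fst
      have h₂ := hab =≫ prod.snd
      simp only [Category.assoc, prod.map_fst, prod.map_snd, Category.comp_id] at h₁ h₂
      refine ⟨prod.lift (pullback.lift (a ≫ prod.fst) (b ≫ prod.fst) (by simpa using h₁))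
        (a ≫ prod.snd), ?_, ?_⟩
      · ext <;> simp
      · ext <;> simp [h₂]
  have e₁ (f : pullback e e ⟶ L) :
      prod.lift (𝟙 _) 0 ≫ prod.map f (𝟙 K') = f ≫ prod.lift (𝟙 L) 0 := by ext <;> simp
  have e₂ (f : pullback e e ⟶ L) :
      prod.lift 0 (𝟙 K') ≫ prod.map f (𝟙 K') = prod.lift 0 (𝟙 K') := by ext <;> simp
  obtain ⟨ψ, hψ⟩ := IsRegularEpi.exists_of_isKernelPair _ kp' φ (prod_hom_ext
    (by rw [reassoc_of% e₁, reassoc_of% e₁, h₁, reassoc_of% kp.w])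
    (by rw [reassoc_of% e₂, reassoc_of% e₂]))
  refine ⟨ψ, ?_, ?_⟩
  · rw [← cancel_epi e, ← h₁, ← hψ, ← Category.assoc, ← Category.assoc]
    congr 1; ext <;> simp
  · rw [← h₂, ← hψ, ← Category.assoc]
    congr 1; ext <;> simp

lemma of_regularEpi_comp_right {L : C} (e : L ⟶ K') [IsRegularEpi e] (h : Cooperate k (e ≫ k')) :
    Cooperate k k' :=
  (of_regularEpi_comp_left e h.symm).symm

end Cooperate

/-- The universal quotient `q` of `P` making a morphism `k : K ⟶ P` central. -/
lemma exists_universal_cooperate {K P : C} (k : K ⟶ P) :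
    ∃ (Q : C) (q : P ⟶ Q), IsRegularEpi q ∧ Cooperate (k ≫ q) q ∧
      ∀ {T : C} (t : P ⟶ T), Cooperate (k ≫ t) t → ∃ y, q ≫ y = t := by
  have : IsSplitEpi (coprod.desc k (𝟙 P)) := IsSplitEpi.mk' ⟨coprod.inr, by simp⟩
  -- A cocone on `P ⟵ K ⨿ P ⟶ K ⨯ P` is a morphism `t` out of `P` with a cooperator for `k ≫ t` and
  -- `t`; the pushout is the universal one.
  obtain ⟨Q, q, φ, w, hq, -, hQ, -⟩ := exists_regularPushout (coprod.desc k (𝟙 P))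
    (coprod.desc (prod.lift (𝟙 K) (0 : K ⟶ P)) (prod.lift (0 : P ⟶ K) (𝟙 P)))
  refine ⟨Q, q, hq, ⟨φ, by simpa using (coprod.inl ≫= w).symm,
    by simpa using (coprod.inr ≫= w).symm⟩, fun {T} t ht => ?_⟩
  obtain ⟨ψ, h₁, h₂⟩ := ht
  obtain ⟨y, hy, -⟩ := hQ t ψ (by ext <;> simp [h₁, h₂])
  exact ⟨y, hy⟩

namespace isAbelianObject

lemma cooperate {A K L : C} (hA : isAbelianObject C A) (k : K ⟶ A) (l : L ⟶ A) :
    Cooperate k l := by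
  simpa using Cooperate.precomp hA k l

lemma of_cooperate_self {X A : C} (q : X ⟶ A) [IsRegularEpi q] (h : Cooperate q q) :
    isAbelianObject C A :=
  Cooperate.of_regularEpi_comp_left q (Cooperate.of_regularEpi_comp_right q (by simpa using h))

lemma of_regularEpi {X A : C} (hX : isAbelianObject C X) (q : X ⟶ A) [IsRegularEpi q] :
    isAbelianObject C A :=
  of_cooperate_self q (by simpa using Cooperate.comp hX q)

lemma prod_obj {A B : C} (hA : isAbelianObject C A) (hB : isAbelianObject C B) :
    isAbelianObject C (A ⨯ B) := by
  obtain ⟨φ, h₁, h₂⟩ := hA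
  obtain ⟨ψ, h₃, h₄⟩ := hB
  refine ⟨prod.lift (prod.map (prod.fst : A ⨯ B ⟶ A) (prod.fst : A ⨯ B ⟶ A) ≫ φ)
    (prod.map (prod.snd : A ⨯ B ⟶ B) (prod.snd : A ⨯ B ⟶ B) ≫ ψ), ?_, ?_⟩
  · have e₁ : prod.lift (𝟙 (A ⨯ B)) 0 ≫ prod.map (prod.fst : A ⨯ B ⟶ A) (prod.fst : A ⨯ B ⟶ A) =
      prod.fst ≫ prod.lift (𝟙 A) 0 := by ext <;> simp
    have e₂ : prod.lift (𝟙 (A ⨯ B)) 0 ≫ prod.map (prod.snd : A ⨯ B ⟶ B) (prod.snd : A ⨯ B ⟶ B) =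
      prod.snd ≫ prod.lift (𝟙 B) 0 := by ext <;> simp
    ext
    · simp [reassoc_of% e₁, h₁]
    · simp [reassoc_of% e₂, h₃]
  · have e₁ : prod.lift 0 (𝟙 (A ⨯ B)) ≫ prod.map (prod.fst : A ⨯ B ⟶ A) (prod.fst : A ⨯ B ⟶ A) =
      prod.fst ≫ prod.lift 0 (𝟙 A) := by ext <;> simp
    have e₂ : prod.lift 0 (𝟙 (A ⨯ B)) ≫ prod.map (prod.snd : A ⨯ B ⟶ B) (prod.snd : A ⨯ B ⟶ B) =
      prod.snd ≫ prod.lift 0 (𝟙 B) := by ext <;> simp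
    ext
    · simp [reassoc_of% e₁, h₂]
    · simp [reassoc_of% e₂, h₄]

end isAbelianObject

/-- Existence of the abelianization. -/
lemma exists_abelianization (X : C) :
    ∃ (A : C) (q : X ⟶ A), IsRegularEpi q ∧ isAbelianObject C A ∧
      ∀ {T : C} (t : X ⟶ T), isAbelianObject C T → ∃ y, q ≫ y = t := by
  obtain ⟨A, q, hq, hA, h⟩ := exists_universal_cooperate (𝟙 X)
  exact ⟨A, q, hq, .of_cooperate_self q (by simpa using hA), fun t hT => h t (hT.cooperate _ _)⟩

lemma isPerfect_iff (Y : C) :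
    IsPerfect Y ↔ ∀ {A : C}, isAbelianObject C A → ∀ f : Y ⟶ A, f = 0 := by
  constructor
  · rintro ⟨T, ⟨hT⟩, hz⟩ A hA f
    let F : StructuredArrow Y (isAbelianObject C).ι :=
      StructuredArrow.mk (Y := (⟨A, hA⟩ : Ab C)) f
    have h : T.hom ≫ (isAbelianObject C).ι.map (hT.to F).right = f := StructuredArrow.w (hT.to F)
    rw [← h, show T.hom = 0 from hz.eq_of_tgt _ _, zero_comp]
  · intro h
    have hz : IsZero (0 : C) := isZero_zero C
    have h0 : isAbelianObject C (0 : C) := ⟨0, hz.eq_of_tgt _ _, hz.eq_of_tgt _ _⟩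
    let T : StructuredArrow Y (isAbelianObject C).ι :=
      StructuredArrow.mk (Y := (⟨0, h0⟩ : Ab C)) (0 : Y ⟶ (0 : C))
    refine ⟨T, ⟨IsInitial.ofUniqueHom
      (fun S => StructuredArrow.homMk ⟨(0 : (0 : C) ⟶ S.right.obj)⟩ ?_) ?_⟩, hz⟩
    · rw [h S.right.property S.hom]
      exact zero_comp
    · intro S m
      ext
      exact hz.eq_of_src _ _

end Cooperators

lemma isPullback_prod_map_id {C : Type u} [Category.{v} C] [HasBinaryProducts C] (K : C)
    {U F : C} (j : U ⟶ F) :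
    IsPullback (prod.map (𝟙 K) j) prod.snd prod.snd j := by
  refine IsPullback.mk' (by simp) (fun T a b h₁ h₂ => ?_) (fun T a b h => ?_)
  · have := h₁ =≫ prod.fst
    simp only [Category.assoc, prod.map_fst, Category.comp_id] at this
    ext
    · exact this
    · exact h₂
  · exact ⟨prod.lift (a ≫ prod.fst) b, by ext <;> simp [h], by simp⟩

/-! ### Central extensions and weak initiality. -/

section CentralExtensions

variable {C : Type u} [Category.{v} C] [HasZeroMorphisms C] [SemiAbelianCategory C]

/-- For a central extension `x : X ⟶ Y` with kernel `B`, the kernel pair of `x` is `B ⨯ X`. -/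
lemma exists_isPullback_of_central {X Y : C} (x : X ⟶ Y) (h : Cooperate (kernel.ι x) (𝟙 X)) :
    ∃ φ : kernel x ⨯ X ⟶ X, prod.lift (𝟙 _) 0 ≫ φ = kernel.ι x ∧ prod.lift 0 (𝟙 X) ≫ φ = 𝟙 X ∧
      IsPullback φ prod.snd x x := by
  obtain ⟨φ, h₁, h₂⟩ := h
  refine ⟨φ, h₁, h₂, ?_⟩
  have w : φ ≫ x = prod.snd ≫ x :=
    prod_hom_ext (by simp [reassoc_of% h₁]) (by simp [reassoc_of% h₂])
  let θ : kernel x ⨯ X ⟶ pullback x x := pullback.lift φ prod.snd w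
  have hθ₁ : θ ≫ pullback.fst x x = φ := by simp [θ]
  have hθ₂ : θ ≫ pullback.snd x x = prod.snd := by simp [θ]
  have hZ : IsZero (kernel (𝟙 X)) := isZero_kernel_of_mono _
  let ι : kernel x ⟶ kernel x ⨯ X := prod.lift (𝟙 _) 0
  have left : IsPullback ι (0 : _ ⟶ kernel (𝟙 X)) (prod.snd : kernel x ⨯ X ⟶ X) 0 :=
    isPullback_zero_of_kernel hZ (by simp [ι])
      (fun t ht => ⟨t ≫ prod.fst, by ext <;> simp [ι, ht]⟩)
  have : Mono (ι ≫ θ) := mono_of_mono_fac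
    (show (ι ≫ θ) ≫ pullback.fst x x = kernel.ι x by rw [Category.assoc, hθ₁, h₁])
  have outer : IsPullback (ι ≫ θ) (0 : _ ⟶ kernel (𝟙 X)) (pullback.snd x x) 0 := by
    refine isPullback_zero_of_kernel hZ (by simp [ι, hθ₂]) (fun t ht => ?_)
    refine ⟨kernel.lift x (t ≫ pullback.fst x x) ?_, ?_⟩
    · rw [Category.assoc, pullback.condition, reassoc_of% ht, zero_comp]
    · ext
      · simp [hθ₁, ι, h₁]
      · simp [hθ₂, ι, ht]
  have split : IsSplitEpi (prod.snd : kernel x ⨯ X ⟶ X) :=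
    IsSplitEpi.mk' ⟨prod.lift 0 (𝟙 X), by simp⟩
  -- Both objects are split over `X` with the same kernel, so protomodularity acts as a short five
  -- lemma for `θ`.
  have hθ := Protomodular.isPullback_right ι θ 0 (𝟙 X) 0 prod.snd (pullback.snd x x) split
    left.toCommSq ⟨by simp [hθ₂]⟩ left (by simpa using outer)
  have := hθ.isIso_fst_of_isIso
  exact IsPullback.of_iso_pullback ⟨w⟩ (asIso θ) hθ₁ hθ₂

/-- The kernel of a central extension is abelian. -/
lemma isAbelianObject_kernel_of_central {X Y : C} (x : X ⟶ Y)
    (h : Cooperate (kernel.ι x) (𝟙 X)) : isAbelianObject C (kernel x) :=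
  Cooperate.of_comp_mono (kernel.ι x) (by simpa using h.precomp (𝟙 _) (kernel.ι x))

/-- Morphisms from a perfect object to a central extension are determined by their composite with
the extension. -/
lemma eq_of_isPerfect_of_central {U X Y : C} (hU : IsPerfect U) (x : X ⟶ Y)
    (h : Cooperate (kernel.ι x) (𝟙 X)) (s t : U ⟶ X) (hst : s ≫ x = t ≫ x) : s = t := by
  obtain ⟨φ, -, h₂, hφ⟩ := exists_isPullback_of_central x h
  -- The "difference" of `s` and `t`: their component in the abelian kernel of `x`.
  have h0 := (isPerfect_iff U).1 hU (isAbelianObject_kernel_of_central x h)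
    (hφ.lift s t hst ≫ prod.fst)
  have e : hφ.lift s t hst = t ≫ prod.lift 0 (𝟙 X) := by
    refine Limits.prod.hom_ext ?_ ?_
    · simpa using h0
    · simp
  rw [← hφ.lift_fst s t hst, e, Category.assoc, h₂, Category.comp_id]

/-- With enough projectives, every object has a weakly initial central extension. -/
lemma exists_weaklyInitial_central (hproj : HasEnoughRegularProjectives C) (Y : C) :
    ∃ (F : C) (f : F ⟶ Y), IsRegularEpi f ∧ Cooperate (kernel.ι f) (𝟙 F) ∧
      ∀ {X : C} (x : X ⟶ Y), IsRegularEpi x → Cooperate (kernel.ι x) (𝟙 X) →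
        ∃ t : F ⟶ X, t ≫ x = f := by
  obtain ⟨P, p, hP, hp⟩ := hproj Y
  obtain ⟨F, q, hq, hc, huniv⟩ := exists_universal_cooperate (kernel.ι p)
  obtain ⟨f, rfl⟩ := huniv p ⟨prod.snd ≫ p, by simp, by simp⟩
  have hf : IsRegularEpi f := isRegularEpi_of_comp q f
  let e : kernel (q ≫ f) ⟶ kernel f := kernel.lift f (kernel.ι (q ≫ f) ≫ q) (by simp)
  have he : e ≫ kernel.ι f = kernel.ι (q ≫ f) ≫ q := by simp [e]
  have hpb : IsPullback e (kernel.ι (q ≫ f)) (kernel.ι f) q :=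
    IsPullback.mk' he (fun T a b _ h => (cancel_mono (kernel.ι (q ≫ f))).1 h)
      (fun T a b hab => ⟨kernel.lift (q ≫ f) b (by rw [← reassoc_of% hab]; simp), by
        rw [← cancel_mono (kernel.ι f), Category.assoc, he]; simp [hab], by simp⟩)
  have := isRegularEpi_fst_of_isPullback hpb
  refine ⟨F, f, hf, ?_, fun {X} x hx hxc => ?_⟩
  · refine Cooperate.of_regularEpi_comp_left e (Cooperate.of_regularEpi_comp_right q ?_)
    rwa [he, Category.comp_id]
  · obtain ⟨t, ht⟩ := hP x hx (q ≫ f)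
    -- The lift `t` sends `ker p` into the central `ker x`, so it factors through the universal
    -- quotient `q`.
    have hk : (kernel.ι (q ≫ f) ≫ t) ≫ x = 0 := by rw [Category.assoc, ht, kernel.condition]
    obtain ⟨y, hy⟩ := huniv t (by
      have := hxc.precomp (kernel.lift x _ hk) t
      rwa [kernel.lift_ι, Category.comp_id] at this)
    refine ⟨y, ?_⟩
    rw [← cancel_epi q, reassoc_of% hy, ht]

/-! ### The commutator subobject of an extension of a perfect object. -/

section Derived

variable {F Y A : C} {f : F ⟶ Y} {q : F ⟶ A}

/-- The commutator subobject of an extension of a perfect object is again an extension. -/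
lemma isRegularEpi_kernel_abelianization_comp (hY : IsPerfect Y) [IsRegularEpi f] [IsRegularEpi q]
    (hA : isAbelianObject C A) : IsRegularEpi (kernel.ι q ≫ f) := by
  obtain ⟨G, g, g', w, hg, hg', -, hl⟩ := exists_regularPushout f q
  -- `G` is a quotient of the abelian `A` and of the perfect `Y`. Hence `F ⟶ Y ⨯ A` is a regular
  -- epimorphism, and `kernel.ι q ≫ f` is its pullback along `(1, 0)`.
  have hG : IsZero G := by
    rw [IsZero.iff_id_eq_zero, ← cancel_epi g, (isPerfect_iff Y).1 hY (hA.of_regularEpi g') g]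
    simp
  have hprod : IsPullback (prod.fst : Y ⨯ A ⟶ Y) prod.snd g g' :=
    IsPullback.mk' (hG.eq_of_tgt _ _) (fun T a b h₁ h₂ => by ext <;> assumption)
      (fun T a b _ => ⟨prod.lift a b, by simp, by simp⟩)
  have := hl _ _ (prod.lift f q) hprod (by simp) (by simp)
  refine isRegularEpi_fst_of_isPullback (b := kernel.ι q) (f := prod.lift (𝟙 Y) (0 : Y ⟶ A))
    (g := prod.lift f q) (IsPullback.mk' (by ext <;> simp) ?_ ?_)
  · exact fun T a b _ h => (cancel_mono (kernel.ι q)).1 h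
  · intro T a b hab
    have h₁ := hab =≫ prod.fst
    have h₂ := hab =≫ prod.snd
    simp at h₁ h₂
    exact ⟨kernel.lift q b h₂.symm, by simp [h₁], by simp⟩

/-- A subobject of a central extension has central kernel. -/
lemma Cooperate.kernel_comp_mono (h : Cooperate (kernel.ι f) (𝟙 F)) {U : C} (j : U ⟶ F) [Mono j] :
    Cooperate (kernel.ι (j ≫ f)) (𝟙 U) :=
  Cooperate.of_comp_mono j
    (by simpa using h.precomp (kernel.lift f (kernel.ι (j ≫ f) ≫ j) (by simp)) j)

/-- The commutator subobject of a central extension of a perfect object is perfect. -/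
lemma isPerfect_kernel_abelianization (hY : IsPerfect Y) [IsRegularEpi f]
    (hf : Cooperate (kernel.ι f) (𝟙 F)) [IsRegularEpi q] (hA : isAbelianObject C A)
    (huniv : ∀ {T : C} (t : F ⟶ T), isAbelianObject C T → ∃ y, q ≫ y = t) :
    IsPerfect (kernel q) := by
  have := isRegularEpi_kernel_abelianization_comp (f := f) (q := q) hY hA
  obtain ⟨B, b, hb, hB, hbuniv⟩ := exists_abelianization (kernel q)
  obtain ⟨φ, -, h₂, hφ⟩ := exists_isPullback_of_central f hf
  -- For groups: `F` is generated by the central `ker f` and `[F,F]`, whence `[F,F] =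
  -- [[F,F],[F,F]]`.
  let ψ := prod.map (𝟙 (kernel f)) (kernel.ι q) ≫ φ
  have : IsRegularEpi ψ := isRegularEpi_fst_of_isPullback
    ((isPullback_prod_map_id (kernel f) (kernel.ι q)).paste_horiz hφ)
  have : IsRegularEpi (prod.map (𝟙 (kernel f)) b) :=
    isRegularEpi_fst_of_isPullback (isPullback_prod_map_id (kernel f) b)
  have hψ : prod.lift 0 (𝟙 (kernel q)) ≫ ψ = kernel.ι q := by
    have e : prod.lift 0 (𝟙 (kernel q)) ≫ prod.map (𝟙 (kernel f)) (kernel.ι q) =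
      kernel.ι q ≫ prod.lift 0 (𝟙 F) := by ext <;> simp
    simp only [ψ]
    rw [reassoc_of% e, h₂, Category.comp_id]
  obtain ⟨G, g, g', w, hg, hg', -, hl⟩ := exists_regularPushout ψ (prod.map (𝟙 (kernel f)) b)
  -- `G` is a quotient of the abelian `kernel f ⨯ B`, so `g` kills `kernel q`.
  obtain ⟨y, rfl⟩ := huniv g
    (((isAbelianObject_kernel_of_central f hf).prod_obj hB).of_regularEpi g')
  let l := pullback.lift ψ (prod.map (𝟙 (kernel f)) b) w
  have : IsRegularEpi l := hl _ _ l (IsPullback.of_hasPullback _ _) (by simp [l]) (by simp [l])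
  -- The point `(u, 0)` lies in the pullback, so it lifts, after a cover, to some `(k, u')` with `k
  -- = 0` and `b u' = 0`. Applying `ψ` gives `u' = u`, hence `b = 0`.
  let c : kernel q ⟶ pullback (q ≫ y) g' := pullback.lift (kernel.ι q) 0 (by simp)
  let z := pullback.fst l c
  have hz : z ≫ l = pullback.snd l c ≫ c := pullback.condition
  have hz₁ : z ≫ ψ = pullback.snd l c ≫ kernel.ι q := by
    simpa [l, c] using hz =≫ pullback.fst _ _
  have hz₂ : z ≫ prod.map (𝟙 (kernel f)) b = 0 := by
    simpa [l, c] using hz =≫ pullback.snd _ _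
  have hz₃ : z ≫ prod.fst = 0 := by simpa using hz₂ =≫ prod.fst
  have hz₄ : z ≫ prod.snd ≫ b = 0 := by simpa using hz₂ =≫ prod.snd
  have hz₅ : z = (z ≫ prod.snd) ≫ prod.lift 0 (𝟙 _) := by ext <;> simp [hz₃]
  have hz₆ : z ≫ prod.snd = pullback.snd l c := by
    rw [← cancel_mono (kernel.ι q), ← hz₁, ← hψ, ← Category.assoc, ← hz₅]
  have hb0 : b = 0 := by
    rw [← cancel_epi (pullback.snd l c), ← hz₆, Category.assoc, hz₄, comp_zero]
  rw [isPerfect_iff]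
  intro T hT t
  obtain ⟨t', rfl⟩ := hbuniv t hT
  rw [hb0, zero_comp]

end Derived

/-- Product projections along abelian objects are central extensions. -/
lemma cooperate_kernel_prod_fst (Y : C) {A : C} (hA : isAbelianObject C A) :
    Cooperate (kernel.ι (prod.fst : Y ⨯ A ⟶ Y)) (𝟙 (Y ⨯ A)) := by
  obtain ⟨m, h₁, h₂⟩ := hA.cooperate
    (kernel.ι (prod.fst : Y ⨯ A ⟶ Y) ≫ prod.snd) (prod.snd : Y ⨯ A ⟶ A)
  -- The `Y`-coordinate comes from the second factor alone; the `A`-coordinates are added.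
  refine ⟨prod.lift (prod.snd ≫ prod.fst) m, ?_, ?_⟩
  · ext <;> simp [h₁]
  · ext <;> simp [h₂]

end CentralExtensions

end SemiAb

/-! ### The characterization of perfect objects. -/

theorem mainTheorem9 {C : Type u} [Category.{v} C] [HasZeroMorphisms C]
    [SemiAb.SemiAbelianCategory C] (hproj : SemiAb.HasEnoughRegularProjectives C) (Y : C) :
    SemiAb.IsPerfect Y ↔ ∃ U : SemiAb.Centr Y, SemiAb.IsUniversalCentralExtension U := by
  constructor
  · intro hY
    obtain ⟨F, f, hf, hc, hweak⟩ := SemiAb.exists_weaklyInitial_central hproj Y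
    obtain ⟨A, q, hq, hA, huniv⟩ := SemiAb.exists_abelianization F
    have hreg := SemiAb.isRegularEpi_kernel_abelianization_comp (f := f) (q := q) hY hA
    have hU : SemiAb.IsPerfect (kernel q) :=
      SemiAb.isPerfect_kernel_abelianization (f := f) hY hc hA huniv
    choose t ht using fun X : SemiAb.Centr Y =>
      hweak X.obj.hom X.property.1 X.property.2
    refine ⟨⟨Over.mk (kernel.ι q ≫ f), hreg, hc.kernel_comp_mono (kernel.ι q)⟩,
      ⟨IsInitial.ofUniqueHom
        (fun X => ⟨Over.homMk (kernel.ι q ≫ t X) ((Category.assoc _ _ _).trans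
          (congrArg (kernel.ι q ≫ ·) (ht X)))⟩) ?_⟩⟩
    intro X m
    ext
    exact SemiAb.eq_of_isPerfect_of_central hU X.obj.hom X.property.2 _ _
      ((Over.w m.hom).trans ((Category.assoc _ _ _).trans
          (congrArg (kernel.ι q ≫ ·) (ht X))).symm)
  · rintro ⟨U, ⟨hU⟩⟩
    rw [SemiAb.isPerfect_iff]
    intro A hA f
    have hs : IsSplitEpi (prod.fst : Y ⨯ A ⟶ Y) :=
      IsSplitEpi.mk' ⟨prod.lift (𝟙 Y) 0, prod.lift_fst _ _⟩
    let X : SemiAb.Centr Y := ⟨Over.mk (prod.fst : Y ⨯ A ⟶ Y),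
      (inferInstance : IsRegularEpi (prod.fst : Y ⨯ A ⟶ Y)),
      SemiAb.cooperate_kernel_prod_fst Y hA⟩
    have : IsRegularEpi U.obj.hom := U.property.1
    let u : U.obj.left ⟶ Y := U.obj.hom
    let a (v : U.obj.left ⟶ A) : U ⟶ X := ⟨Over.homMk (prod.lift u v) (prod.lift_fst _ _)⟩
    have h : prod.lift u (u ≫ f) = prod.lift u 0 :=
      congrArg (fun m : U ⟶ X => m.hom.left) (hU.hom_ext (a (u ≫ f)) (a 0))
    have h' := h =≫ prod.snd
    rw [prod.lift_snd, prod.lift_snd] at h'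
    have : Epi u := inferInstanceAs (Epi U.obj.hom)
    rw [← cancel_epi u, h', comp_zero]
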